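/- Let $K$ be an algebraically closed field (for instance the algebraic closure of a finite field $\mathbb{F}_q$), let $m\ge 2$ be an integer not divisible by the characteristic of $K$, and let $F/K(x)$ be the Kummer extension of degree $m$ defined by $y^m=f(x)$, where $f\in K(x)$ is a rational function; that is, $F=K(x)(y)$, $y^m=f$, and $Y^m-f$ is irreducible over $K(x)$. Let $Q_1,\dots,Q_r$ be all the places of $K(x)$ that are zeros or poles of $f$, listed without repetition, and put $\lambda_i:=v_{Q_i}(f)\in\mathbb{Z}$. Let $0\le s\le r$ and let $P_1,\dots,P_s$ be pairwise distinct places of $F$ that are totally ramified in $F/K(x)$, where $P_i$ lies over $Q_i$ for $i=1,\dots,s$. For a divisor $D$ of $F$ let $\ell(D)$ be the dimension over $K$ of $\mathcal{L}(D)=\{z\in F\setminus\{0\}:(z)\ge -D\}\cup\{0\}$. For $\mathbf{c}=(c_1,\dots,c_s)$ and $\mathbf{n}=(n_1,\dots,n_s)$ with non-negative integer entries, $\mathbf{n}$ is called a $\mathbf{c}$-gap at $(P_1,\dots,P_s)$ if $$\ell\Big(\sum_{i=1}^s (n_i-c_i)P_i\Big)=\ell\Big(\sum_{i=1}^s n_iP_i\Big).$$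 Theorem. The tuple $\mathbf{n}$ is a $\mathbf{c}$-gap at $(P_1,\dots,P_s)$ if and only if for every $t\in\{0,\dots,m-1\}$ at least one of the following two conditions holds: (i) $\displaystyle\sum_{i=1}^s\left\lfloor\frac{n_i+t\lambda_i}{m}\right\rfloor+\sum_{i=s+1}^r\left\lfloor\frac{t\lambda_i}{m}\right\rfloor<0$; (ii) $\displaystyle\left\lfloor\frac{n_i+t\lambda_i}{m}\right\rfloor=\left\lfloor\frac{n_i-c_i+t\lambda_i}{m}\right\rfloor$ for all $i\in\{1,\dots,s\}$. -/

import Mathlib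

open scoped WithZero

/-- A place `P` of a function field `F / K`, given by its normalized discrete valuation: a
valuation of `F` that is trivial on `K` and whose value group is exactly `ℤ`. It is written
multiplicatively: `v z = exp (-v_P(z))` for `z ≠ 0`, and `v 0 = 0`. The map sending such a
valuation to the maximal ideal of its valuation ring `{z | v z ≤ 1}` is the usual bijection onto
the places of `F / K`. -/
@[ext]
structure Place (K F : Type*) [Field K] [Field F] [Algebra K F] where
  /-- the normalized discrete valuation, in multiplicative notation -/
  v : Valuation F ℤᵐ⁰
  /-- the valuation is trivial on the constants -/
  trivial_on : ∀ a : K, a ≠ 0 → v (algebraMap K F a) = 1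
  /-- the valuation is normalized -/
  surjective : Function.Surjective v

namespace Place

/-- The order `v_P(z) ∈ ℤ` of a function `z ≠ 0` at the place `P` (with the value `0` for
`z = 0`). -/
noncomputable def ord {K F : Type*} [Field K] [Field F] [Algebra K F]
    (P : Place K F) (z : F) : ℤ :=
  -WithZero.log (P.v z)

/-- The place `P` of `F` lies over the place `Q` of the subfield `E`: the valuation ring of `P`
intersects `E` in the valuation ring of `Q`. -/
def LiesOver {K E F : Type*} [Field K] [Field E] [Field F] [Algebra K E] [Algebra K F]
    [Algebra E F] (P : Place K F) (Q : Place K E) : Prop :=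
  ∀ z : E, P.v (algebraMap E F z) ≤ 1 ↔ Q.v z ≤ 1

/-- The ramification index `e(P|Q)` of a place `P` lying over `Q`: the (unique) natural number
`e` such that `v_P(z) = e * v_Q(z)` for every `z` in the subfield `E`. -/
noncomputable def ramificationIdx {K E F : Type*} [Field K] [Field E] [Field F] [Algebra K E]
    [Algebra K F] [Algebra E F] (P : Place K F) (Q : Place K E) : ℕ :=
  sInf {e : ℕ | ∀ z : E, P.v (algebraMap E F z) = Q.v z ^ e}

/-- `P` lies over `Q` and is totally ramified: `e(P|Q) = [F : E]`. -/
def IsTotallyRamified {K E F : Type*} [Field K] [Field E] [Field F] [Algebra K E]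
    [Algebra K F] [Algebra E F] (P : Place K F) (Q : Place K E) : Prop :=
  P.LiesOver Q ∧ P.ramificationIdx Q = Module.finrank E F

end Place

/-- The Riemann-Roch space `𝓛(D) = {z ∈ F : (z) ≥ -D} ∪ {0}` of a divisor `D`, as a `K`-vector
space. In multiplicative notation, `v_P(z) ≥ -D(P)` reads `v z ≤ exp (D P)`, which holds for
`z = 0`. -/
def riemannRochSpace {K F : Type*} [Field K] [Field F] [Algebra K F]
    (D : Place K F →₀ ℤ) : Submodule K F where
  carrier := {z | ∀ P : Place K F, P.v z ≤ WithZero.exp (D P)}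
  add_mem' := fun ha hb P => P.v.map_add_le (ha P) (hb P)
  zero_mem' := fun P => by simp
  smul_mem' := fun c z hz P => by
    rw [Algebra.smul_def, map_mul]
    by_cases hc : c = 0
    · simp [hc]
    · rw [P.trivial_on c hc, one_mul]
      exact hz P

theorem mem_riemannRochSpace_iff {K F : Type*} [Field K] [Field F] [Algebra K F]
    (D : Place K F →₀ ℤ) (z : F) :
    z ∈ riemannRochSpace D ↔ z = 0 ∨ ∀ P : Place K F, -D P ≤ P.ord z := by
  change (∀ P : Place K F, P.v z ≤ WithZero.exp (D P)) ↔ _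
  by_cases hz : z = 0
  · simp [hz]
  · simp only [hz, false_or, Place.ord, neg_le_neg_iff]
    refine forall_congr' fun P => ?_
    rw [WithZero.log_le_iff_le_exp (by simpa using hz)]

/-- The dimension `ℓ(D)` of the Riemann-Roch space of `D` over the constant field `K`. -/
noncomputable def ell {K F : Type*} [Field K] [Field F] [Algebra K F]
    (D : Place K F →₀ ℤ) : ℕ :=
  Module.finrank K (riemannRochSpace D)

/-- `n` is a `c`-gap at `(P₁, …, P_s)`: `ℓ(∑ (nᵢ - cᵢ) Pᵢ) = ℓ(∑ nᵢ Pᵢ)`. -/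
def IsCGap {K F : Type*} [Field K] [Field F] [Algebra K F] {s : ℕ}
    (P : Fin s → Place K F) (c n : Fin s → ℕ) : Prop :=
  ell (∑ i, Finsupp.single (P i) ((n i : ℤ) - (c i : ℤ))) =
    ell (∑ i, Finsupp.single (P i) (n i : ℤ))

/-- `F / K(x)` is the Kummer extension of degree `m` defined by the equation `y ^ m = f(x)`:
`m ≥ 2` is not divisible by the characteristic, the equation is irreducible over `K(x)`,
and `F = K(x)(y)`. -/
structure IsKummerExtension (K F : Type*) [Field K] [Field F] [Algebra (RatFunc K) F]
    (m : ℕ) (f : RatFunc K) (y : F) : Prop where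
  two_le : 2 ≤ m
  char_not_dvd : (m : K) ≠ 0
  irreducible : Irreducible (Polynomial.X ^ m - Polynomial.C f : Polynomial (RatFunc K))
  pow_eq : y ^ m = algebraMap (RatFunc K) F f
  adjoin_eq : IntermediateField.adjoin (RatFunc K) {y} = ⊤

/-!
Write `E = K(x)`. The theorem follows from a formula for `ℓ(D)` when `D = ∑ dᵢ Pᵢ`.

Since `K` contains a primitive `m`-th root of unity `ζ`, the extension `F / E` has the
automorphism `y ↦ ζ y`, and the component `a_t y ^ t` of `z = ∑ a_t y ^ t` is a `K`-linear
combination of the conjugates of `z` (`IsKummerExtension.repr_smul_pow_mem`). A totally ramified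
place is the only place over its restriction to `E` (`Place.eq_of_totallyRamified`), so `D` is
invariant under `y ↦ ζ y` and `z ∈ 𝓛(D)` exactly when every `a_t y ^ t` lies in `𝓛(D)`.

At a place `R` over `S` with ramification index `e`, the relation `m v_R(y) = e v_S(f)` turns the
condition on `a_t y ^ t` into `v_S(a_t) ≥ -⌊(d + t v_S(f)) / m⌋`, where `d = dᵢ` if `R = Pᵢ` and
`d = 0` if `R` is none of the `Pᵢ` (`IsKummerExtension.v_smul_pow_le_iff`). Every place of `F`
lies over one of `E`, and every place of `E` lies below one of `F`, so `𝓛(D)` is isomorphic to the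
direct sum over `t < m` of the spaces `𝓛(D_t)` on `E`, where
`D_t = ∑_{i ≤ s} ⌊(dᵢ + t λᵢ) / m⌋ Qᵢ + ∑_{i > s} ⌊t λᵢ / m⌋ Qᵢ`. On `K(x)` one has
`ℓ(D_t) = max (deg D_t + 1) 0` (`ell_ratFunc`), because every divisor is equivalent to a multiple of
the place at infinity.

Lowering `dᵢ` from `nᵢ` to `nᵢ - cᵢ` lowers each `deg D_t`, so `ℓ(D)` is unchanged exactly when each
summand is: either `deg D_t` was already negative, or none of its coefficients changes.
-/

/-! ### Comparison of valuations and the places of `K(x)` -/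

namespace Place

section Comparison

variable {K F : Type*} [Field K] [Field F] [Algebra K F]

theorem exists_uniformizer (P : Place K F) : ∃ π : F, π ≠ 0 ∧ P.v π = WithZero.exp (-1) := by
  obtain ⟨π, hπ⟩ := P.surjective (WithZero.exp (-1))
  exact ⟨π, by rintro rfl; exact WithZero.exp_ne_zero (hπ.symm.trans P.v.map_zero), hπ⟩

theorem v_ne_zero (P : Place K F) {z : F} (hz : z ≠ 0) : P.v z ≠ 0 :=
  (Valuation.ne_zero_iff _).mpr hz

theorem v_eq_exp_neg_ord (P : Place K F) {z : F} (hz : z ≠ 0) :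
    P.v z = WithZero.exp (-P.ord z) := by
  rw [ord, neg_neg, WithZero.exp_log (P.v_ne_zero hz)]

/-- A nontrivial discrete valuation whose valuation ring contains that of a place `P` is a positive
power of `v_P`. This one fact gives both the ramification index of a place over its restriction and,
in `eq_of_forall_le_one`, the equality of places with comparable valuation rings. -/
theorem exists_v_eq_pow (P : Place K F) (w : Valuation F ℤᵐ⁰)
    (hle : ∀ z, P.v z ≤ 1 → w z ≤ 1) (hw : ∃ z, z ≠ 0 ∧ w z ≠ 1) :
    ∃ e : ℕ, 0 < e ∧ ∀ z, w z = P.v z ^ e := by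
  obtain ⟨π, hπ0, hπ⟩ := P.exists_uniformizer
  have hunit : ∀ z, P.v z = 1 → w z = 1 := fun z hz => by
    refine le_antisymm (hle z hz.le) ?_
    have h := hle z⁻¹ (by simp [hz])
    have hz0 : z ≠ 0 := by rintro rfl; simp at hz
    rw [map_inv₀] at h
    exact (inv_le_one₀ (zero_lt_iff.mpr ((Valuation.ne_zero_iff _).mpr hz0))).mp h
  -- every nonzero element is a unit at `P` times a power of `π`
  have hpow : ∀ z, z ≠ 0 → w z = w π ^ P.ord z := fun z hz => by
    have h : w (z * π ^ (-P.ord z)) = 1 := hunit _ (by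
      rw [map_mul, map_zpow₀, hπ, P.v_eq_exp_neg_ord hz, ← WithZero.exp_zsmul, ← WithZero.exp_add]
      simp)
    rw [map_mul, map_zpow₀, zpow_neg] at h
    exact (mul_inv_eq_one₀ (zpow_ne_zero _ ((Valuation.ne_zero_iff _).mpr hπ0))).mp h
  have hwπ0 : w π ≠ 0 := (Valuation.ne_zero_iff _).mpr hπ0
  have hle1 : w π ≤ 1 := hle π (by rw [hπ, ← WithZero.exp_zero, WithZero.exp_le_exp]; lia)
  have hlog : WithZero.log (w π) < 0 := by
    rw [← WithZero.exp_log hwπ0, ← WithZero.exp_zero, WithZero.exp_le_exp] at hle1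
    refine lt_of_le_of_ne hle1 fun h => ?_
    obtain ⟨z, hz, hz1⟩ := hw
    refine hz1 ?_
    rw [hpow z hz, ← WithZero.exp_log hwπ0, h, WithZero.exp_zero, one_zpow]
  refine ⟨(-WithZero.log (w π)).toNat, by lia, fun z => ?_⟩
  by_cases hz : z = 0
  · subst hz
    rw [map_zero, map_zero, zero_pow (by lia)]
  · rw [hpow z hz, P.v_eq_exp_neg_ord hz, ← WithZero.exp_nsmul]
    nth_rw 1 [← WithZero.exp_log hwπ0]
    rw [← WithZero.exp_zsmul]
    congr 1
    rw [nsmul_eq_mul, Int.toNat_of_nonneg (by lia), smul_eq_mul]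
    ring

/-- Valuation rings of places are maximal subrings, so an inclusion of them is an equality. -/
theorem eq_of_forall_le_one {P P' : Place K F} (h : ∀ z, P.v z ≤ 1 → P'.v z ≤ 1) : P = P' := by
  obtain ⟨π', hπ0, hπ'⟩ := P'.exists_uniformizer
  obtain ⟨e, he, hP⟩ := P.exists_v_eq_pow P'.v h
    ⟨π', hπ0, by rw [hπ', ← WithZero.exp_zero, Ne, WithZero.exp_inj]; lia⟩
  -- the exponent divides the value `1` of `P'` at a uniformizer
  have he1 : e = 1 := by
    have h1 := hP π'
    rw [hπ', P.v_eq_exp_neg_ord hπ0, ← WithZero.exp_nsmul, WithZero.exp_inj, nsmul_eq_mul] at h1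
    have h2 : (e : ℤ) ∣ 1 := ⟨P.ord π', by linarith⟩
    exact_mod_cast Int.eq_one_of_dvd_one (by lia) h2
  ext z : 2
  rw [hP z, he1, pow_one]

end Comparison

section RatFunc

variable {K : Type*} [Field K]

open Classical in
/-- The place of `K(x)` at infinity. -/
noncomputable def infty (K : Type*) [Field K] : Place K (RatFunc K) where
  v := RatFunc.inftyValuation K
  trivial_on a ha := by
    rw [RatFunc.algebraMap_eq_C]; exact RatFunc.inftyValuation.C K ha
  surjective := by
    intro a
    by_cases ha : a = 0
    · exact ⟨0, by simp [ha]⟩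
    · exact ⟨RatFunc.X ^ WithZero.log a, by
        rw [RatFunc.inftyValuation.X_zpow, WithZero.exp_log ha]⟩

/-- The place of `K(x)` attached to a maximal ideal of `K[x]`. -/
noncomputable def adic (u : IsDedekindDomain.HeightOneSpectrum (Polynomial K)) :
    Place K (RatFunc K) where
  v := u.valuation (RatFunc K)
  trivial_on a ha := by
    rw [IsScalarTower.algebraMap_apply K (Polynomial K) (RatFunc K),
      u.valuation_eq_one_iff_notMem]
    intro h
    exact u.isPrime.ne_top (Ideal.eq_top_of_isUnit_mem _ h
      ((Polynomial.isUnit_C.mpr (Ne.isUnit ha))))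
  surjective := u.valuation_surjective (RatFunc K)

theorem infty_ne_adic (u : IsDedekindDomain.HeightOneSpectrum (Polynomial K)) :
    adic u ≠ infty K := by
  classical
  intro h
  have := congrArg Place.v h
  refine RatFunc.adicValuation_ne_inftyValuation u ?_
  convert! this

/-- Ostrowski's theorem for `K(x)`, in a form that applies to the restriction of a place of an
extension field, where the valuation need not be normalized. -/
theorem exists_v_eq_pow_of_isNontrivial (w : Valuation (RatFunc K) ℤᵐ⁰)
    (htriv : ∀ a : K, a ≠ 0 → w (algebraMap K (RatFunc K) a) = 1)
    (hw : ∃ z, z ≠ 0 ∧ w z ≠ 1) :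
    ∃ Q : Place K (RatFunc K), (Q = infty K ∨ ∃ u, Q = adic u) ∧
      ∃ e : ℕ, 0 < e ∧ ∀ z, w z = Q.v z ^ e := by
  classical
  have : w.IsTrivialOn K := ⟨htriv⟩
  have : w.IsNontrivial := by
    obtain ⟨z, hz, hz1⟩ := hw
    exact ⟨z, (Valuation.ne_zero_iff _).mpr hz, hz1⟩
  have : w.IsRankOneDiscrete := Valuation.IsRankOneDiscrete.mk' w
  have key : ∀ Q : Place K (RatFunc K), w.IsEquiv Q.v →
      ∃ e : ℕ, 0 < e ∧ ∀ z, w z = Q.v z ^ e := fun Q h =>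
    Q.exists_v_eq_pow w (fun z hz => h.le_one_iff_le_one.mpr hz) hw
  rcases (RatFunc.valuation_isEquiv_infty_or_adic (v := w)).or with h | h
  · exact ⟨infty K, Or.inl rfl, key _ (by convert! h)⟩
  · obtain ⟨u, hu, -⟩ := h
    exact ⟨adic u, Or.inr ⟨u, rfl⟩, key _ hu⟩

theorem eq_infty_or_exists_eq_adic (Q : Place K (RatFunc K)) :
    Q = infty K ∨ ∃ u, Q = adic u := by
  obtain ⟨π, hπ0, hπ⟩ := Q.exists_uniformizer
  obtain ⟨Q', hQ', e, he, h⟩ := exists_v_eq_pow_of_isNontrivial Q.v Q.trivial_on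
    ⟨π, hπ0, by rw [hπ, ← WithZero.exp_zero, Ne, WithZero.exp_inj]; lia⟩
  have : Q' = Q := eq_of_forall_le_one fun z hz => by rw [h z]; exact pow_le_one₀ zero_le hz
  rwa [← this]

theorem infty_v_X_sub_C (a : K) :
    (infty K).v (algebraMap (Polynomial K) (RatFunc K) (Polynomial.X - Polynomial.C a))
      = WithZero.exp 1 := by
  classical
  have h := RatFunc.inftyValuation.polynomial K (Polynomial.X_sub_C_ne_zero a)
  rw [Polynomial.natDegree_X_sub_C] at h
  rw [show WithZero.exp (1 : ℤ) = WithZero.exp ((1 : ℕ) : ℤ) from rfl, ← h]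
  change RatFunc.inftyValuationDef K _ = _
  congr

/-- The divisor of `g` is `Q - ∞`: take `g = x - a` if `Q` is the place at `a`, and `g = 1` if `Q`
is the place at infinity. -/
theorem exists_function_of_place [IsAlgClosed K] (Q : Place K (RatFunc K)) :
    ∃ g : RatFunc K, g ≠ 0 ∧ ∀ R : Place K (RatFunc K),
      R.v g * WithZero.exp (Finsupp.single Q (1 : ℤ) R) =
        WithZero.exp (Finsupp.single (infty K) (1 : ℤ) R) := by
  classical
  rcases Q.eq_infty_or_exists_eq_adic with rfl | ⟨u, rfl⟩
  · exact ⟨1, one_ne_zero, fun R => by simp⟩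
  obtain ⟨p, hp⟩ : ∃ p : Polynomial K, u.asIdeal = Ideal.span {p} :=
    ⟨_, (IsPrincipalIdealRing.principal u.asIdeal).principal.choose_spec⟩
  have hpp : Prime p := by
    rw [← Ideal.span_singleton_prime, ← hp]
    · exact u.isPrime
    · rintro rfl
      exact u.ne_bot (by simpa using hp)
  -- the maximal ideal contains a linear polynomial, as `K` is algebraically closed
  obtain ⟨a, ha⟩ := IsAlgClosed.exists_root p (by
    rw [IsAlgClosed.degree_eq_one_of_irreducible K hpp.irreducible]; exact one_ne_zero)
  have hass : Associated (Polynomial.X - Polynomial.C a) p :=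
    (Polynomial.irreducible_X_sub_C a).associated_of_dvd hpp.irreducible
      (Polynomial.dvd_iff_isRoot.mpr ha)
  have hu : u.asIdeal = Ideal.span {Polynomial.X - Polynomial.C a} := by
    rw [hp]; exact (Ideal.span_singleton_eq_span_singleton.mpr hass).symm
  refine ⟨algebraMap _ _ (Polynomial.X - Polynomial.C a),
    (map_ne_zero_iff _ (FaithfulSMul.algebraMap_injective _ _)).mpr
      (Polynomial.X_sub_C_ne_zero a), fun R => ?_⟩
  rcases R.eq_infty_or_exists_eq_adic with rfl | ⟨u', rfl⟩
  · rw [infty_v_X_sub_C, Finsupp.single_eq_same,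
      Finsupp.single_eq_of_ne (infty_ne_adic u).symm, WithZero.exp_zero, mul_one]
  rw [Finsupp.single_eq_of_ne (infty_ne_adic u'), WithZero.exp_zero]
  change u'.valuation _ _ * _ = 1
  by_cases huu : u' = u
  · subst huu
    rw [Finsupp.single_eq_same, IsDedekindDomain.HeightOneSpectrum.valuation_of_algebraMap,
      u'.intValuation_singleton (Polynomial.X_sub_C_ne_zero a) hu, ← WithZero.exp_add]
    rfl
  · have hne : adic u' ≠ adic u := fun h => huu
      (IsDedekindDomain.HeightOneSpectrum.eq_of_valuation_isEquiv_valuation (K := RatFunc K)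
        (by rw [show u'.valuation (RatFunc K) = u.valuation (RatFunc K) from
          congrArg Place.v h]))
    rw [Finsupp.single_eq_of_ne hne, WithZero.exp_zero, mul_one, u'.valuation_eq_one_iff_notMem]
    intro hmem
    refine huu (IsDedekindDomain.HeightOneSpectrum.ext ?_)
    exact (u.isMaximal.eq_of_le u'.isPrime.ne_top
      (by rw [hu, Ideal.span_singleton_le_iff_mem]; exact hmem)).symm

end RatFunc

end Place

/-! ### Riemann-Roch spaces of `K(x)` -/

namespace Place

variable {K : Type*} [Field K]

/-- Every divisor of `K(x)` is linearly equivalent to a multiple of the place at infinity. -/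
theorem exists_function_of_divisor [IsAlgClosed K] (D : Place K (RatFunc K) →₀ ℤ) :
    ∃ g : RatFunc K, g ≠ 0 ∧ ∀ R : Place K (RatFunc K),
      R.v g * WithZero.exp (D R) =
        WithZero.exp (Finsupp.single (infty K) D.degree R) := by
  classical
  induction D using Finsupp.induction_linear with
  | zero => exact ⟨1, one_ne_zero, fun R => by simp⟩
  | add D D' hD hD' =>
    obtain ⟨g, hg, h⟩ := hD
    obtain ⟨g', hg', h'⟩ := hD'
    refine ⟨g * g', mul_ne_zero hg hg', fun R => ?_⟩
    rw [map_add, Finsupp.single_add, Finsupp.add_apply, Finsupp.add_apply, WithZero.exp_add,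
      WithZero.exp_add, ← h R, ← h' R, map_mul, mul_mul_mul_comm]
  | single Q k =>
    obtain ⟨g, hg, h⟩ := Q.exists_function_of_place
    refine ⟨g ^ k, zpow_ne_zero _ hg, fun R => ?_⟩
    have key : ∀ S : Place K (RatFunc K),
        Finsupp.single S k R = k • Finsupp.single S (1 : ℤ) R := by
      intro S
      rw [← Finsupp.smul_apply, Finsupp.smul_single, smul_eq_mul, mul_one]
    rw [Finsupp.degree_single, key, key, WithZero.exp_zsmul, WithZero.exp_zsmul, ← h R, mul_zpow,
      map_zpow₀]

end Place

section RiemannRoch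

variable {K : Type*} [Field K]

/-- `𝓛(d ∞)` consists of the polynomials of degree at most `d`; for `d < 0` the truncation of
`d + 1` to `0` leaves only the zero polynomial. -/
theorem mem_riemannRochSpace_single_infty (d : ℤ) (z : RatFunc K) :
    z ∈ riemannRochSpace (Finsupp.single (Place.infty K) d) ↔
      ∃ p ∈ Polynomial.degreeLT K (d + 1).toNat, algebraMap (Polynomial K) (RatFunc K) p = z := by
  classical
  change (∀ P : Place K (RatFunc K), P.v z ≤ WithZero.exp _) ↔ _
  have hinf : ∀ p : Polynomial K, p ≠ 0 →
      (Place.infty K).v (algebraMap (Polynomial K) (RatFunc K) p)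
        = WithZero.exp (p.natDegree : ℤ) := fun p hp => by
    rw [← RatFunc.inftyValuation.polynomial K hp]
    change RatFunc.inftyValuationDef K _ = _
    congr
  constructor
  · intro h
    obtain ⟨p, rfl⟩ :=
      IsDedekindDomain.HeightOneSpectrum.mem_integers_of_valuation_le_one (RatFunc K) z
        fun u => by
          have := h (Place.adic u)
          rwa [Finsupp.single_eq_of_ne (Place.infty_ne_adic u), WithZero.exp_zero] at this
    refine ⟨p, Polynomial.mem_degreeLT.mpr ?_, rfl⟩
    by_cases hp : p = 0
    · simp [hp]
    have h1 := h (Place.infty K)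
    rw [hinf p hp, Finsupp.single_eq_same, WithZero.exp_le_exp] at h1
    rw [Polynomial.degree_eq_natDegree hp, Nat.cast_lt]
    lia
  · rintro ⟨p, hp, rfl⟩ P
    by_cases hp0 : p = 0
    · simp [hp0]
    rw [Polynomial.mem_degreeLT, Polynomial.degree_eq_natDegree hp0, Nat.cast_lt] at hp
    rcases P.eq_infty_or_exists_eq_adic with rfl | ⟨u, rfl⟩
    · rw [hinf p hp0, Finsupp.single_eq_same, WithZero.exp_le_exp]
      lia
    · rw [Finsupp.single_eq_of_ne (Place.infty_ne_adic u), WithZero.exp_zero]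
      exact u.valuation_le_one p

variable [IsAlgClosed K]

/-- If `g` has divisor `D - (deg D) ∞`, then `p ↦ p / g` identifies the polynomials of degree at
most `deg D` with `𝓛(D)`. -/
noncomputable def degreeLTEquivRiemannRochSpace (D : Place K (RatFunc K) →₀ ℤ) :
    Polynomial.degreeLT K (D.degree + 1).toNat ≃ₗ[K] riemannRochSpace D :=
  let g := (Place.exists_function_of_divisor D).choose
  have hg : g ≠ 0 := (Place.exists_function_of_divisor D).choose_spec.1
  have hv := (Place.exists_function_of_divisor D).choose_spec.2
  let φ : Polynomial K →ₗ[K] RatFunc K :=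
    LinearMap.mulLeft K g⁻¹ ∘ₗ (Algebra.linearMap (Polynomial K) (RatFunc K)).restrictScalars K
  have hφ : Function.Injective φ := fun p q h =>
    FaithfulSMul.algebraMap_injective _ _ (mul_left_cancel₀ (inv_ne_zero hg) h)
  (Submodule.equivMapOfInjective φ hφ _).trans (LinearEquiv.ofEq _ _ (by
    ext z
    have hz : z ∈ riemannRochSpace D ↔
        g * z ∈ riemannRochSpace (Finsupp.single (Place.infty K) D.degree) := by
      refine forall_congr' fun R => ?_
      rw [← hv R, map_mul, mul_le_mul_iff_right₀ (zero_lt_iff.mpr (R.v_ne_zero hg))]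
    rw [hz, mem_riemannRochSpace_single_infty, Submodule.mem_map]
    refine exists_congr fun p => and_congr_right fun _ => ?_
    exact inv_mul_eq_iff_eq_mul₀ hg))

instance finite_riemannRochSpace (D : Place K (RatFunc K) →₀ ℤ) :
    Module.Finite K (riemannRochSpace D) :=
  Module.Finite.equiv (degreeLTEquivRiemannRochSpace D)

theorem ell_ratFunc (D : Place K (RatFunc K) →₀ ℤ) : ell D = (D.degree + 1).toNat := by
  rw [ell, ← (degreeLTEquivRiemannRochSpace D).finrank_eq,
    (Polynomial.degreeLTEquiv K _).finrank_eq, Module.finrank_fin_fun]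

end RiemannRoch

/-! ### Extension and restriction of places -/

namespace Place

section Extension

/-- A place is nontrivial on a subfield over which `F` is algebraic. -/
theorem exists_algebraMap_v_ne_one {K E F : Type*} [Field K] [Field E] [Field F] [Algebra K F]
    [Algebra E F] [Algebra.IsAlgebraic E F] (P : Place K F) :
    ∃ z : E, z ≠ 0 ∧ P.v (algebraMap E F z) ≠ 1 := by
  by_contra! h
  have : P.v.IsTrivialOn E := ⟨h⟩
  obtain ⟨π, hπ0, hπ⟩ := P.exists_uniformizer
  refine P.v.transcendental_of_ne_one (A := E) π hπ0 ?_ (Algebra.IsAlgebraic.isAlgebraic π)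
  rw [hπ, ← WithZero.exp_zero, Ne, WithZero.exp_inj]
  lia

variable {K E F : Type*} [Field K] [Field E] [Field F] [Algebra K E] [Algebra K F] [Algebra E F]

theorem exists_algebraMap_v_eq_pow [Algebra.IsAlgebraic E F] {P : Place K F} {Q : Place K E}
    (h : ∀ z : E, Q.v z ≤ 1 → P.v (algebraMap E F z) ≤ 1) :
    ∃ e : ℕ, 0 < e ∧ ∀ z : E, P.v (algebraMap E F z) = Q.v z ^ e :=
  Q.exists_v_eq_pow (P.v.comap (algebraMap E F)) h P.exists_algebraMap_v_ne_one

/-- Every place `Q` of `E` has a place of `F` above it: localize the integral closure of the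
valuation ring of `Q` at any of its maximal ideals. -/
theorem exists_place_above [IsScalarTower K E F] [FiniteDimensional E F] [Algebra.IsSeparable E F]
    (Q : Place K E) :
    ∃ P : Place K F, ∀ z : E, Q.v z ≤ 1 → P.v (algebraMap E F z) ≤ 1 := by
  obtain ⟨π, hπ0, hπ⟩ := Q.exists_uniformizer
  have : Q.v.IsNontrivial := ⟨π, Q.v_ne_zero hπ0, by
    rw [hπ, ← WithZero.exp_zero, Ne, WithZero.exp_inj]; lia⟩
  let A := Q.v.valuationSubring
  let B := integralClosure A F
  have : IsDedekindDomain B := integralClosure.isDedekindDomain A E F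
  have : IsFractionRing B F := IsIntegralClosure.isFractionRing_of_finite_extension A E F B
  have hB : ¬ IsField B := fun h => Q.v.valuationSubring_not_isField
    (isField_of_isIntegral_of_isField
      (fun a b hab => Subtype.ext ((algebraMap E F).injective
        (congrArg (algebraMap B F) hab))) h)
  obtain ⟨M, hM⟩ := Ideal.exists_maximal B
  let u : IsDedekindDomain.HeightOneSpectrum B :=
    ⟨M, hM.isPrime, Ring.ne_bot_of_isMaximal_of_not_isField hM hB⟩
  have hle : ∀ z : E, Q.v z ≤ 1 → u.valuation F (algebraMap E F z) ≤ 1 := fun z hz =>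
    u.valuation_le_one (algebraMap A B ⟨z, hz⟩)
  -- triviality on `K` holds because both `a` and `a⁻¹` are integral at `Q`
  refine ⟨⟨u.valuation F, fun a ha => ?_, u.valuation_surjective F⟩, hle⟩
  have h1 := hle (algebraMap K E a) (Q.trivial_on a ha).le
  have h2 := hle (algebraMap K E a⁻¹) (Q.trivial_on _ (inv_ne_zero ha)).le
  rw [← IsScalarTower.algebraMap_apply] at h1 h2
  rw [map_inv₀, map_inv₀] at h2
  have h0 : algebraMap K F a ≠ 0 := by simpa using ha
  exact le_antisymm h1
    ((inv_le_one₀ (zero_lt_iff.mpr ((Valuation.ne_zero_iff _).mpr h0))).mp h2)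

section TotallyRamified

variable {P : Place K F} {Q : Place K E}

/-- If `v_P` is `m` times `v_Q` on `E` and `π` is a uniformizer at `P`, then the terms of
`∑ bᵢ π ^ i` with `i < m` have distinct orders at `P`, so the order of the sum is the least of
them. -/
theorem v_smul_pow_le_sum {m : ℕ} {π : F}
    (hP : ∀ z : E, P.v (algebraMap E F z) = Q.v z ^ m)
    (hπ : P.v π = WithZero.exp (-1)) (b : Fin m → E) (j : Fin m) :
    P.v (b j • π ^ (j : ℕ)) ≤ P.v (∑ i, b i • π ^ (i : ℕ)) := by
  have hv : ∀ i : Fin m, b i ≠ 0 → P.v (b i • π ^ (i : ℕ)) =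
      WithZero.exp (-(m * Q.ord (b i) + (i : ℕ))) := fun i hi => by
    rw [Algebra.smul_def, map_mul, map_pow, hP, hπ, Q.v_eq_exp_neg_ord hi, ← WithZero.exp_nsmul,
      ← WithZero.exp_nsmul, ← WithZero.exp_add]
    congr 1
    simp only [nsmul_eq_mul]
    ring
  obtain ⟨k, -, hk⟩ := Finset.exists_max_image Finset.univ
    (fun i : Fin m => P.v (b i • π ^ (i : ℕ))) ⟨j, Finset.mem_univ j⟩
  by_cases hbk : b k = 0
  · have h := hk j (Finset.mem_univ j)
    rw [hbk, zero_smul, map_zero] at h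
    exact h.trans zero_le
  rw [Valuation.map_sum_eq_of_lt _ (Finset.mem_univ k)]
  · exact hk j (Finset.mem_univ j)
  intro i hi
  simp only [Finset.mem_sdiff, Finset.mem_univ, Finset.mem_singleton, true_and] at hi
  refine lt_of_le_of_ne (hk i (Finset.mem_univ i)) fun h => ?_
  by_cases hbi : b i = 0
  · rw [hbi, zero_smul, map_zero, hv k hbk] at h
    exact WithZero.exp_ne_zero h.symm
  -- two terms of equal order would have indices congruent modulo `m`
  rw [hv i hbi, hv k hbk, WithZero.exp_inj, neg_inj] at h
  refine hi (Fin.ext ?_)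
  have h1 := congrArg (· % (m : ℤ)) h
  simp only [Int.mul_add_emod_self_left] at h1
  rw [Int.emod_eq_of_lt (Int.natCast_nonneg _) (Int.ofNat_lt.mpr i.2),
    Int.emod_eq_of_lt (Int.natCast_nonneg _) (Int.ofNat_lt.mpr k.2)] at h1
  exact_mod_cast h1

/-- A totally ramified place `P` is the only place over its restriction `Q`. The powers `π ^ j` of a
uniformizer at `P` form a basis of `F / E` in which the elements integral at `P` have coordinates
integral at `Q`; these elements are therefore bounded at any other place `P'` over `Q`, and being
closed under powers they are integral at `P'`. -/
theorem eq_of_totallyRamified [FiniteDimensional E F] {P' : Place K F}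
    (hP : ∀ z : E, P.v (algebraMap E F z) = Q.v z ^ Module.finrank E F)
    (hP' : ∀ z : E, Q.v z ≤ 1 → P'.v (algebraMap E F z) ≤ 1) : P = P' := by
  set m := Module.finrank E F with hm
  have hm0 : 0 < m := Module.finrank_pos
  obtain ⟨π, hπ0, hπ⟩ := P.exists_uniformizer
  have hli : LinearIndependent E (fun j : Fin m => π ^ (j : ℕ)) := by
    rw [Fintype.linearIndependent_iff]
    intro b hb j
    have h := v_smul_pow_le_sum hP hπ b j
    rw [hb, map_zero, le_zero_iff, Valuation.zero_iff] at h
    exact (smul_eq_zero.mp h).resolve_right (pow_ne_zero _ hπ0)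
  have : Nonempty (Fin m) := ⟨⟨0, hm0⟩⟩
  let B := basisOfLinearIndependentOfCardEqFinrank hli (by simp [hm])
  set N : ℕ := m * (WithZero.log (P'.v π)).toNat with hN
  have hbound : ∀ z, P.v z ≤ 1 → P'.v z ≤ WithZero.exp (N : ℤ) := fun z hz => by
    have hz' : ∑ j, B.repr z j • π ^ (j : ℕ) = z := by
      conv_rhs => rw [← B.sum_repr z]
      simp [B]
    rw [← hz']
    refine Valuation.map_sum_le _ fun j _ => ?_
    have h := (v_smul_pow_le_sum hP hπ (fun j => B.repr z j) j).trans (hz'.symm ▸ hz)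
    have hb : Q.v (B.repr z j) ≤ 1 := by
      by_cases hb0 : B.repr z j = 0
      · simp [hb0]
      rw [Algebra.smul_def, map_mul, map_pow, hP, hπ, Q.v_eq_exp_neg_ord hb0,
        ← WithZero.exp_nsmul, ← WithZero.exp_nsmul, ← WithZero.exp_add, ← WithZero.exp_zero,
        WithZero.exp_le_exp] at h
      rw [Q.v_eq_exp_neg_ord hb0, ← WithZero.exp_zero, WithZero.exp_le_exp]
      simp only [nsmul_eq_mul] at h
      have hj : ((j : ℕ) : ℤ) < m := by exact_mod_cast j.2
      nlinarith
    rw [Algebra.smul_def, map_mul, map_pow]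
    refine (mul_le_of_le_one_left' (hP' _ hb)).trans ?_
    rw [← WithZero.exp_log (P'.v_ne_zero hπ0), ← WithZero.exp_nsmul, WithZero.exp_le_exp,
      nsmul_eq_mul, hN]
    push_cast
    exact (mul_le_mul_of_nonneg_left (Int.self_le_toNat _) (Int.natCast_nonneg _)).trans
      (mul_le_mul_of_nonneg_right (Int.ofNat_le.mpr j.2.le) (Int.natCast_nonneg _))
  -- all powers of `z` obey the same bound at `P'`, so it is integral there
  refine eq_of_forall_le_one fun z hz => ?_
  by_cases hz0 : z = 0
  · simp [hz0]
  have h := hbound (z ^ (N + 1)) (by rw [map_pow]; exact pow_le_one₀ zero_le hz)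
  rw [map_pow, P'.v_eq_exp_neg_ord hz0, ← WithZero.exp_nsmul, WithZero.exp_le_exp,
    nsmul_eq_mul] at h
  rw [P'.v_eq_exp_neg_ord hz0, ← WithZero.exp_zero, WithZero.exp_le_exp]
  push_cast at h
  by_contra! hlt
  nlinarith

/-- For a totally ramified place the infimum defining the ramification index is attained; the degree
must be positive, as `sInf ∅ = 0`. -/
theorem IsTotallyRamified.v_algebraMap (h : P.IsTotallyRamified Q)
    (h2 : 0 < Module.finrank E F) (z : E) :
    P.v (algebraMap E F z) = Q.v z ^ Module.finrank E F := by
  rw [← h.2]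
  have hne : P.ramificationIdx Q ≠ 0 := by rw [h.2]; exact h2.ne'
  exact Nat.sInf_mem (s := {e : ℕ | ∀ z : E, P.v (algebraMap E F z) = Q.v z ^ e})
    (Nat.nonempty_of_sInf_eq_succ (Nat.succ_pred_eq_of_ne_zero hne).symm) z

end TotallyRamified

/-- The place `z ↦ v_P(σ z)`, for an `E`-endomorphism `σ` of `F`. -/
def comap [IsScalarTower K E F] [FiniteDimensional E F] (P : Place K F) (σ : F →ₐ[E] F) :
    Place K F where
  v := P.v.comap σ
  trivial_on a ha := by
    rw [Valuation.comap_apply, IsScalarTower.algebraMap_apply K E F]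
    simp [← IsScalarTower.algebraMap_apply, P.trivial_on a ha]
  surjective := P.surjective.comp
    (LinearMap.injective_iff_surjective.mp (show Function.Injective σ.toLinearMap from σ.injective))

end Extension

section RatFunc

variable {K F : Type*} [Field K] [Field F] [Algebra K F] [Algebra (RatFunc K) F]
  [IsScalarTower K (RatFunc K) F] [Algebra.IsAlgebraic (RatFunc K) F]

/-- The restriction of `v_P` to `K(x)` is a power of the normalized valuation of a place. -/
theorem exists_place_below (P : Place K F) :
    ∃ Q : Place K (RatFunc K), ∃ e : ℕ, 0 < e ∧
      ∀ z, P.v (algebraMap (RatFunc K) F z) = Q.v z ^ e := by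
  obtain ⟨Q, -, h⟩ := exists_v_eq_pow_of_isNontrivial (P.v.comap (algebraMap (RatFunc K) F))
    (fun a ha => by
      rw [Valuation.comap_apply, ← IsScalarTower.algebraMap_apply]; exact P.trivial_on a ha)
    P.exists_algebraMap_v_ne_one
  exact ⟨Q, h⟩

end RatFunc

end Place

/-! ### Kummer extensions: basis, automorphisms, orders of the terms `a y ^ t` -/

namespace IsKummerExtension

open Polynomial

variable {K F : Type*} [Field K] [Field F] [Algebra (RatFunc K) F] {m : ℕ} {f : RatFunc K} {y : F}

theorem ne_zero (hF : IsKummerExtension K F m f y) : f ≠ 0 := by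
  rintro rfl
  have h := hF.irreducible
  rw [map_zero, sub_zero] at h
  exact not_irreducible_pow (by have := hF.two_le; lia) h

theorem minpoly_eq (hF : IsKummerExtension K F m f y) :
    minpoly (RatFunc K) y = X ^ m - C f :=
  (minpoly.eq_of_irreducible_of_monic hF.irreducible (by simp [hF.pow_eq])
    (monic_X_pow_sub_C f (by have := hF.two_le; lia))).symm

theorem isIntegral (hF : IsKummerExtension K F m f y) : IsIntegral (RatFunc K) y :=
  ⟨X ^ m - C f, monic_X_pow_sub_C f (by have := hF.two_le; lia), by
    rw [← aeval_def]; simp [hF.pow_eq]⟩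

/-- The power basis of `F` over `K(x)` generated by `y`. -/
noncomputable def powerBasis (hF : IsKummerExtension K F m f y) : PowerBasis (RatFunc K) F :=
  PowerBasis.ofAdjoinEqTop hF.isIntegral
    ((IntermediateField.adjoin_simple_eq_top_iff_of_isAlgebraic hF.isIntegral.isAlgebraic).mp
      hF.adjoin_eq)

theorem powerBasis_gen (hF : IsKummerExtension K F m f y) : hF.powerBasis.gen = y := rfl

theorem powerBasis_dim (hF : IsKummerExtension K F m f y) : hF.powerBasis.dim = m := by
  rw [powerBasis, PowerBasis.ofAdjoinEqTop_dim, hF.minpoly_eq, natDegree_X_pow_sub_C]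

/-- The basis `1, y, …, y ^ (m - 1)` of `F` over `K(x)`, indexed by `Fin m`. -/
noncomputable def basis (hF : IsKummerExtension K F m f y) :
    Module.Basis (Fin m) (RatFunc K) F :=
  hF.powerBasis.basis.reindex (finCongr hF.powerBasis_dim)

theorem basis_apply (hF : IsKummerExtension K F m f y) (t : Fin m) :
    hF.basis t = y ^ (t : ℕ) := by
  simp [basis, powerBasis_gen]

theorem finiteDimensional (hF : IsKummerExtension K F m f y) : FiniteDimensional (RatFunc K) F :=
  hF.powerBasis.finite

theorem finrank_eq (hF : IsKummerExtension K F m f y) : Module.finrank (RatFunc K) F = m := by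
  rw [hF.powerBasis.finrank, hF.powerBasis_dim]

theorem isSeparable (hF : IsKummerExtension K F m f y) : Algebra.IsSeparable (RatFunc K) F := by
  have hy : IsSeparable (RatFunc K) y := by
    rw [IsSeparable, hF.minpoly_eq]
    refine separable_X_pow_sub_C f ?_ hF.ne_zero
    rw [← map_natCast (algebraMap K (RatFunc K))]
    exact (_root_.map_ne_zero _).mpr hF.char_not_dvd
  have h := (IntermediateField.isSeparable_adjoin_simple_iff_isSeparable (RatFunc K) F).mpr hy
  rw [hF.adjoin_eq] at h
  exact Algebra.IsSeparable.of_algHom (RatFunc K) _ IntermediateField.topEquiv.symm.toAlgHom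

theorem exists_algHom (hF : IsKummerExtension K F m f y) {ξ : RatFunc K} (hξ : ξ ^ m = 1) :
    ∃ σ : F →ₐ[RatFunc K] F, σ y = ξ • y := by
  refine ⟨hF.powerBasis.lift (ξ • y) ?_, hF.powerBasis.lift_gen _ _⟩
  rw [powerBasis_gen, hF.minpoly_eq]
  simp [_root_.smul_pow, hξ, hF.pow_eq]

variable [Algebra K F]

/-- The order condition on a term `a y ^ t` at `R`, as an order condition on `a` at the place `S`
below `R`. It follows from `m v_R(y) = e v_S(f)`. The bound on the right involves `d / m`, whereas
the general one would be `d / e`; hence the restriction on `d`. -/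
theorem v_smul_pow_le_iff (hF : IsKummerExtension K F m f y) {R : Place K F}
    {S : Place K (RatFunc K)} {e : ℕ} (he : 0 < e)
    (hR : ∀ z, R.v (algebraMap (RatFunc K) F z) = S.v z ^ e) (a : RatFunc K) (t : ℕ) {d : ℤ}
    (hd : e = m ∨ d = 0) :
    R.v (a • y ^ t) ≤ WithZero.exp d ↔ S.v a ≤ WithZero.exp ((d + t * S.ord f) / m) := by
  by_cases ha : a = 0
  · simp [ha]
  have hm : (0 : ℤ) < m := by have := hF.two_le; lia
  have hf := hF.ne_zero
  have hy : y ≠ 0 := by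
    rintro rfl
    have h := hF.pow_eq
    rw [zero_pow (by lia)] at h
    exact hf ((map_eq_zero _).mp h.symm)
  have hord : m * R.ord y = e * S.ord f := by
    have h := congrArg R.v hF.pow_eq
    rw [map_pow, hR, R.v_eq_exp_neg_ord hy, S.v_eq_exp_neg_ord hf, ← WithZero.exp_nsmul,
      ← WithZero.exp_nsmul, WithZero.exp_inj, nsmul_eq_mul, nsmul_eq_mul] at h
    linarith
  rw [Algebra.smul_def, map_mul, map_pow, hR, R.v_eq_exp_neg_ord hy, S.v_eq_exp_neg_ord ha,
    ← WithZero.exp_nsmul, ← WithZero.exp_nsmul, ← WithZero.exp_add, WithZero.exp_le_exp,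
    WithZero.exp_le_exp, Int.le_ediv_iff_mul_le hm, nsmul_eq_mul, nsmul_eq_mul]
  have he' : (0 : ℤ) < e := by lia
  have h1 : (m : ℤ) * (e * -S.ord a + t * -R.ord y) = e * (m * -S.ord a - t * S.ord f) := by
    linear_combination (-(t : ℤ)) * hord
  rw [← mul_le_mul_iff_right₀ hm, h1]
  rcases hd with rfl | rfl
  · rw [mul_le_mul_iff_right₀ hm]
    constructor <;> intro h <;> linarith
  · rw [mul_zero, ← mul_zero (e : ℤ), mul_le_mul_iff_right₀ he']
    constructor <;> intro h <;> linarith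

/-- A `K`-subspace of `F` stable under the automorphisms of `F / K(x)` contains the components
`a_t y ^ t` of its elements `z`: with `σ y = ζ y` for a primitive `m`-th root of unity `ζ`, one has
`m a_t y ^ t = ∑ j < m, ζ ^ (-t j) σ ^ j z`. -/
theorem repr_smul_pow_mem [IsScalarTower K (RatFunc K) F] [IsAlgClosed K]
    (hF : IsKummerExtension K F m f y) {V : Submodule K F}
    (hV : ∀ (σ : F →ₐ[RatFunc K] F), ∀ z ∈ V, σ z ∈ V) {z : F} (hz : z ∈ V) (t : Fin m) :
    hF.basis.repr z t • y ^ (t : ℕ) ∈ V := by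
  have : NeZero (m : K) := ⟨hF.char_not_dvd⟩
  have : NeZero m := ⟨by have := hF.two_le; lia⟩
  obtain ⟨ζ, hζ⟩ := HasEnoughRootsOfUnity.exists_primitiveRoot K m
  have hζ0 : ζ ≠ 0 := hζ.ne_zero (NeZero.ne m)
  obtain ⟨σ, hσ⟩ := hF.exists_algHom (ξ := algebraMap K (RatFunc K) ζ)
    (by rw [← map_pow, hζ.pow_eq_one, map_one])
  have hσ' : σ y = ζ • y := by rw [hσ, algebraMap_smul]
  set a := hF.basis.repr z with ha
  have hz' : ∑ u, a u • y ^ (u : ℕ) = z := by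
    conv_rhs => rw [← hF.basis.sum_repr z]
    simp [basis_apply, ha]
  have hσz : ∀ j : ℕ,
      (σ ^ j) z = ∑ u : Fin m, (ζ ^ (u : ℕ)) ^ j • (a u • y ^ (u : ℕ)) := fun j => by
    rw [← hz', map_sum]
    refine Finset.sum_congr rfl fun u _ => ?_
    have hj : (σ ^ j) y = ζ ^ j • y := by
      induction j with
      | zero => simp
      | succ j ih =>
        rw [pow_succ', AlgHom.mul_apply, ih, ← algebraMap_smul (RatFunc K) (ζ ^ j) y, map_smul,
          hσ', algebraMap_smul, smul_smul, pow_succ]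
    rw [map_smul, map_pow, hj, _root_.smul_pow, smul_comm, ← pow_mul, ← pow_mul, mul_comm j]
  -- orthogonality of the characters `j ↦ ζ ^ (u * j)` of the cyclic group of order `m`
  have horth : ∀ u : Fin m, ∑ j ∈ Finset.range m, (ζ ^ (t : ℕ))⁻¹ ^ j * (ζ ^ (u : ℕ)) ^ j =
      if u = t then (m : K) else 0 := fun u => by
    simp_rw [← mul_pow]
    split_ifs with h
    · rw [h, inv_mul_cancel₀ (pow_ne_zero _ hζ0)]
      simp
    · have hne : (ζ ^ (t : ℕ))⁻¹ * ζ ^ (u : ℕ) ≠ 1 := fun h1 => h (Fin.ext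
        (hζ.pow_inj u.2 t.2 ((inv_mul_eq_one₀ (pow_ne_zero _ hζ0)).mp h1).symm))
      have h2 := mul_geom_sum ((ζ ^ (t : ℕ))⁻¹ * ζ ^ (u : ℕ)) m
      have h3 : ((ζ ^ (t : ℕ))⁻¹ * ζ ^ (u : ℕ)) ^ m = 1 := by
        rw [mul_pow, inv_pow, ← pow_mul, ← pow_mul, mul_comm _ m, mul_comm _ m, pow_mul, pow_mul,
          hζ.pow_eq_one, one_pow, one_pow, inv_one, mul_one]
      rw [h3, sub_self] at h2
      exact (mul_eq_zero.mp h2).resolve_left (sub_ne_zero.mpr hne)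
  have hsum : ∑ j ∈ Finset.range m, (ζ ^ (t : ℕ))⁻¹ ^ j • (σ ^ j) z =
      (m : K) • (a t • y ^ (t : ℕ)) := by
    simp_rw [hσz, Finset.smul_sum, smul_smul]
    rw [Finset.sum_comm]
    simp_rw [← Finset.sum_smul, horth]
    simp
  have hmem : ∀ j : ℕ, (σ ^ j) z ∈ V := fun j => hV _ z hz
  rw [← inv_smul_smul₀ hF.char_not_dvd (a t • y ^ (t : ℕ)), ← hsum]
  exact V.smul_mem _ (V.sum_mem fun j _ => V.smul_mem _ (hmem j))

end IsKummerExtension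

/-! ### Decomposition of Riemann-Roch spaces along the Kummer basis -/

section Decomposition

variable {K F : Type*} [Field K] [Field F] [Algebra K F] [Algebra (RatFunc K) F]
  {m : ℕ} {f : RatFunc K} {y : F}

/-- The divisor `D` of `F` has the same coefficient `δ S` at all places over a place `S` of
`K(x)`, and this coefficient is `0` unless the places over `S` have ramification index `m`. -/
def IsConstantOnFibres (m : ℕ) (D : Place K F →₀ ℤ) (δ : Place K (RatFunc K) → ℤ) : Prop :=
  ∀ (R : Place K F) (S : Place K (RatFunc K)) (e : ℕ), 0 < e →
    (∀ z, R.v (algebraMap (RatFunc K) F z) = S.v z ^ e) → D R = δ S ∧ (e = m ∨ δ S = 0)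

namespace IsKummerExtension

/-- Here total ramification enters: `Pᵢ` is the whole fibre over `Qᵢ`. -/
theorem isConstantOnFibres_sum_single {s : ℕ} (hF : IsKummerExtension K F m f y)
    {P : Fin s → Place K F} (hP_inj : Function.Injective P) {Q : Fin s → Place K (RatFunc K)}
    (hQ_inj : Function.Injective Q) (hP : ∀ i, (P i).IsTotallyRamified (Q i)) (d : Fin s → ℤ) :
    IsConstantOnFibres m (∑ i, Finsupp.single (P i) (d i))
      (⇑(∑ i, Finsupp.single (Q i) (d i))) := by
  classical
  intro R S e he hR
  have := hF.finiteDimensional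
  simp only [Finsupp.finsetSum_apply, Finsupp.single_apply]
  by_cases hS : ∃ i, Q i = S
  · obtain ⟨i, rfl⟩ := hS
    have hv := (hP i).v_algebraMap Module.finrank_pos
    obtain rfl : P i = R := Place.eq_of_totallyRamified hv fun z hz => by
      rw [hR]; exact pow_le_one₀ zero_le hz
    refine ⟨by simp [hP_inj.eq_iff, hQ_inj.eq_iff], Or.inl ?_⟩
    obtain ⟨π, hπ0, hπ⟩ := (Q i).exists_uniformizer
    have h := (hR π).symm.trans (hv π)
    rw [hF.finrank_eq, hπ, ← WithZero.exp_nsmul, ← WithZero.exp_nsmul, WithZero.exp_inj,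
      nsmul_eq_mul, nsmul_eq_mul] at h
    lia
  · push Not at hS
    have hRP : ∀ i, P i ≠ R := by
      rintro i rfl
      refine hS i (Place.eq_of_forall_le_one fun z hz => ?_)
      have h := ((hP i).1 z).mpr hz
      rwa [hR, pow_le_one_iff_of_nonneg zero_le he.ne'] at h
    simp [hS, hRP]

variable [IsScalarTower K (RatFunc K) F] {D : Place K F →₀ ℤ} {δ : Place K (RatFunc K) → ℤ}

/-- A divisor that is constant on the fibres is invariant under the automorphisms of `F / K(x)`, and
so is its Riemann-Roch space. -/
theorem map_mem_riemannRochSpace (hF : IsKummerExtension K F m f y)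
    (hD : IsConstantOnFibres m D δ) (σ : F →ₐ[RatFunc K] F) {z : F}
    (hz : z ∈ riemannRochSpace D) : σ z ∈ riemannRochSpace D := fun R => by
  have := hF.finiteDimensional
  obtain ⟨S, e, he, hR⟩ := R.exists_place_below
  have h1 : D (R.comap σ) = δ S := (hD (R.comap σ) S e he fun z => by
    rw [← hR]
    exact congrArg R.v (σ.commutes z)).1
  rw [(hD R S e he hR).1, ← h1]
  exact hz (R.comap σ)

theorem smul_pow_mem_riemannRochSpace_iff (hF : IsKummerExtension K F m f y)
    (hD : IsConstantOnFibres m D δ) {t : ℕ} {D' : Place K (RatFunc K) →₀ ℤ}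
    (hD' : ∀ S, D' S = (δ S + t * S.ord f) / m) (a : RatFunc K) :
    a • y ^ t ∈ riemannRochSpace D ↔ a ∈ riemannRochSpace D' := by
  have := hF.finiteDimensional
  have := hF.isSeparable
  have key : ∀ (R : Place K F) (S : Place K (RatFunc K)) (e : ℕ), 0 < e →
      (∀ z, R.v (algebraMap (RatFunc K) F z) = S.v z ^ e) →
      (R.v (a • y ^ t) ≤ WithZero.exp (D R) ↔ S.v a ≤ WithZero.exp (D' S)) := by
    intro R S e he hR
    obtain ⟨h1, h2⟩ := hD R S e he hR
    rw [h1, hD', hF.v_smul_pow_le_iff he hR a t h2]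
  constructor
  · intro h S
    obtain ⟨R, hle⟩ := S.exists_place_above (F := F)
    obtain ⟨e, he, hR⟩ := Place.exists_algebraMap_v_eq_pow hle
    exact (key R S e he hR).mp (h R)
  · intro h R
    obtain ⟨S, e, he, hR⟩ := R.exists_place_below
    exact (key R S e he hR).mpr (h S)

theorem mem_riemannRochSpace_iff_repr [IsAlgClosed K] (hF : IsKummerExtension K F m f y)
    (hD : IsConstantOnFibres m D δ) {D' : Fin m → Place K (RatFunc K) →₀ ℤ}
    (hD' : ∀ t S, D' t S = (δ S + (t : ℕ) * S.ord f) / m) (z : F) :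
    z ∈ riemannRochSpace D ↔ ∀ t, hF.basis.repr z t ∈ riemannRochSpace (D' t) := by
  simp_rw [fun t => (hF.smul_pow_mem_riemannRochSpace_iff hD (hD' t) (hF.basis.repr z t)).symm]
  refine ⟨fun h t => hF.repr_smul_pow_mem (fun σ z => hF.map_mem_riemannRochSpace hD σ) h t,
    fun h => ?_⟩
  rw [← hF.basis.sum_repr z]
  exact Submodule.sum_mem _ fun t _ => by rw [basis_apply]; exact h t

/-- The Riemann-Roch space of `D` is the direct sum of the Riemann-Roch spaces of the divisors
`D' t` of `K(x)`, through the coordinates in the basis `1, y, …, y ^ (m - 1)`. -/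
noncomputable def riemannRochSpaceEquiv [IsAlgClosed K] (hF : IsKummerExtension K F m f y)
    (hD : IsConstantOnFibres m D δ) {D' : Fin m → Place K (RatFunc K) →₀ ℤ}
    (hD' : ∀ t S, D' t S = (δ S + (t : ℕ) * S.ord f) / m) :
    riemannRochSpace D ≃ₗ[K] (∀ t, riemannRochSpace (D' t)) where
  toFun z t := ⟨hF.basis.repr z t, (hF.mem_riemannRochSpace_iff_repr hD hD' z).mp z.2 t⟩
  map_add' z w := by ext t; simp
  map_smul' c z := by
    ext t
    change hF.basis.repr (c • (z : F)) t = c • hF.basis.repr z t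
    rw [← algebraMap_smul (RatFunc K) c (z : F), map_smul, Finsupp.smul_apply, algebraMap_smul]
  invFun a := ⟨hF.basis.equivFun.symm fun t => (a t : RatFunc K),
    (hF.mem_riemannRochSpace_iff_repr hD hD' _).mpr fun t => by
      rw [← Module.Basis.equivFun_apply, LinearEquiv.apply_symm_apply]; exact (a t).2⟩
  left_inv z := by
    ext
    exact hF.basis.equivFun.symm_apply_apply (z : F)
  right_inv a := by
    ext t
    exact congrFun (hF.basis.equivFun.apply_symm_apply fun t => (a t : RatFunc K)) t

theorem ell_eq_sum [IsAlgClosed K] (hF : IsKummerExtension K F m f y)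
    (hD : IsConstantOnFibres m D δ) {D' : Fin m → Place K (RatFunc K) →₀ ℤ}
    (hD' : ∀ t S, D' t S = (δ S + (t : ℕ) * S.ord f) / m) :
    ell D = ∑ t, ((D' t).degree + 1).toNat := by
  rw [ell, (hF.riemannRochSpaceEquiv hD hD').finrank_eq, Module.finrank_pi_fintype]
  exact Finset.sum_congr rfl fun t _ => ell_ratFunc (D' t)

end IsKummerExtension

end Decomposition

theorem sum_toNat_succ_eq_iff {ι : Type*} {u : Finset ι} {A B : ι → ℤ} (h : ∀ t ∈ u, A t ≤ B t) :
    ∑ t ∈ u, (A t + 1).toNat = ∑ t ∈ u, (B t + 1).toNat ↔ ∀ t ∈ u, B t < 0 ∨ B t = A t := by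
  rw [Finset.sum_eq_sum_iff_of_le fun t ht => by have := h t ht; lia]
  refine forall₂_congr fun t ht => ?_
  have := h t ht
  lia

/-- The coefficient at every place `S` of the divisor `D_t` of `K(x)`; outside the `Qᵢ` both sides
vanish because `f` has order `0` there. -/
theorem sum_single_apply_eq_ediv {K : Type*} [Field K] {f : RatFunc K} {r s : ℕ} (hsr : s ≤ r)
    {Q : Fin r → Place K (RatFunc K)} (hQ_inj : Function.Injective Q)
    (hQ_range : Set.range Q = {R : Place K (RatFunc K) | R.ord f ≠ 0}) (m t : ℕ) (d : Fin s → ℤ)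
    (S : Place K (RatFunc K)) :
    (∑ i : Fin s, Finsupp.single (Q (Fin.castLE hsr i))
          ((d i + t * (Q (Fin.castLE hsr i)).ord f) / m)
        + ∑ i ∈ Finset.univ.filter (fun i : Fin r => s ≤ (i : ℕ)),
          Finsupp.single (Q i) ((t * (Q i).ord f) / (m : ℤ))) S =
      ((∑ i : Fin s, Finsupp.single (Q (Fin.castLE hsr i)) (d i)) S + t * S.ord f) / m := by
  classical
  simp only [Finsupp.add_apply, Finsupp.finsetSum_apply, Finsupp.single_apply]
  by_cases hS : S ∈ Set.range Q
  · obtain ⟨j, rfl⟩ := hS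
    simp only [hQ_inj.eq_iff]
    by_cases hj : (j : ℕ) < s
    · obtain ⟨i, rfl⟩ : ∃ i, Fin.castLE hsr i = j := ⟨⟨j, hj⟩, rfl⟩
      simp [(Fin.castLE_injective hsr).eq_iff]
    · have hne : ∀ i, Fin.castLE hsr i ≠ j := by
        rintro i rfl
        exact hj i.2
      simp [hne, not_lt.mp hj]
  · have h0 : S.ord f = 0 := by
      rw [hQ_range] at hS
      simpa using hS
    have hne : ∀ j, Q j ≠ S := fun j h => hS ⟨j, h⟩
    simp [hne, h0]

theorem mainTheorem1 {K F : Type*} [Field K] [IsAlgClosed K] [Field F] [Algebra K F]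
    [Algebra (RatFunc K) F] [IsScalarTower K (RatFunc K) F]
    (m : ℕ) (f : RatFunc K) (y : F) (hF : IsKummerExtension K F m f y)
    (r s : ℕ) (hsr : s ≤ r)
    -- `Q₁, …, Q_r` are all the zeros and poles of `f`, each listed once
    (Q : Fin r → Place K (RatFunc K)) (hQ_inj : Function.Injective Q)
    (hQ_range : Set.range Q = {R : Place K (RatFunc K) | R.ord f ≠ 0})
    -- `P₁, …, P_s` are pairwise distinct and totally ramified over `Q₁, …, Q_s`
    (P : Fin s → Place K F) (hP_inj : Function.Injective P)
    (hP : ∀ i : Fin s, (P i).IsTotallyRamified (Q (Fin.castLE hsr i)))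
    (c n : Fin s → ℕ) :
    IsCGap P c n ↔
      ∀ t : ℕ, t < m →
        ((∑ i : Fin s,
              ⌊((n i : ℚ) + (t : ℚ) * ((Q (Fin.castLE hsr i)).ord f : ℚ)) / (m : ℚ)⌋)
            + (∑ i ∈ Finset.univ.filter (fun i : Fin r => s ≤ (i : ℕ)),
              ⌊((t : ℚ) * ((Q i).ord f : ℚ)) / (m : ℚ)⌋) < 0) ∨
        (∀ i : Fin s,
          ⌊((n i : ℚ) + (t : ℚ) * ((Q (Fin.castLE hsr i)).ord f : ℚ)) / (m : ℚ)⌋ =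
            ⌊((n i : ℚ) - (c i : ℚ) + (t : ℚ) * ((Q (Fin.castLE hsr i)).ord f : ℚ))
              / (m : ℚ)⌋) := by
  have hm : (0 : ℤ) < m := by have := hF.two_le; lia
  have hell : ∀ d : Fin s → ℤ, ell (∑ i, Finsupp.single (P i) (d i)) =
      ∑ t : Fin m, ((∑ i : Fin s, (d i + (t : ℕ) * (Q (Fin.castLE hsr i)).ord f) / (m : ℤ)
        + ∑ i ∈ Finset.univ.filter (fun i : Fin r => s ≤ (i : ℕ)),
          ((t : ℕ) * (Q i).ord f) / (m : ℤ)) + 1).toNat := fun d => by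
    rw [hF.ell_eq_sum (hF.isConstantOnFibres_sum_single hP_inj
        (hQ_inj.comp (Fin.castLE_injective hsr)) hP d)
      (fun t => sum_single_apply_eq_ediv hsr hQ_inj hQ_range m t d)]
    simp only [map_add, map_sum, Finsupp.degree_single]
  have hle : ∀ (t : ℕ) (i : Fin s),
      ((n i : ℤ) - c i + t * (Q (Fin.castLE hsr i)).ord f) / (m : ℤ) ≤
        ((n i : ℤ) + t * (Q (Fin.castLE hsr i)).ord f) / (m : ℤ) := fun t i =>
    Int.ediv_le_ediv hm (by lia)
  have hfloor : ∀ (a : ℤ), ⌊(a : ℚ) / (m : ℚ)⌋ = a / (m : ℤ) := fun a =>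
    Rat.floor_intCast_div_natCast a m
  rw [IsCGap, hell, hell]
  refine (sum_toNat_succ_eq_iff fun t _ => ?_).trans ?_
  · exact add_le_add (Finset.sum_le_sum fun i _ => hle t i) le_rfl
  simp only [Finset.mem_univ, true_imp_iff]
  refine Fin.forall_iff.trans (forall₂_congr fun t _ => ?_)
  dsimp only
  have h1 : ∀ i : Fin s,
      ⌊((n i : ℚ) + (t : ℚ) * ((Q (Fin.castLE hsr i)).ord f : ℚ)) / (m : ℚ)⌋ =
        ((n i : ℤ) + t * (Q (Fin.castLE hsr i)).ord f) / (m : ℤ) := fun i => by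
    rw [← hfloor]; push_cast; rfl
  have h2 : ∀ i : Fin s,
      ⌊((n i : ℚ) - (c i : ℚ) + (t : ℚ) * ((Q (Fin.castLE hsr i)).ord f : ℚ)) / (m : ℚ)⌋ =
        ((n i : ℤ) - c i + t * (Q (Fin.castLE hsr i)).ord f) / (m : ℤ) := fun i => by
    rw [← hfloor]; push_cast; rfl
  have h3 : ∀ i : Fin r, ⌊((t : ℚ) * ((Q i).ord f : ℚ)) / (m : ℚ)⌋ =
      (t * (Q i).ord f) / (m : ℤ) := fun i => by
    rw [← hfloor]; push_cast; rfl
  simp only [h1, h2, h3, add_left_inj]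
  refine or_congr_right ?_
  -- termwise inequalities whose sums agree are equalities
  rw [eq_comm, Finset.sum_eq_sum_iff_of_le fun i _ => hle t i]
  simp only [Finset.mem_univ, true_imp_iff, eq_comm]
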